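/- Consider the following algorithm on a finite simple graph $G=(V,E)$, run in synchronous rounds. Each vertex $v$ has a fixed cap $\ell_{\max}(v)\in\mathbb N$ and a level $\ell(v)\in\{-\ell_{\max}(v),\dots,\ell_{\max}(v)\}$. In each round, independently of everything else, every vertex $v$ beeps with probability $\min\{2^{-\ell(v)},1\}$ if $\ell(v)<\ell_{\max}(v)$, and does not beep if $\ell(v)=\ell_{\max}(v)$. Then all levels are updated simultaneously: if at least one neighbor of $v$ beeped, then $\ell(v)\gets\min\{\ell(v)+1,\ell_{\max}(v)\}$; otherwise, if $v$ itself beeped, then $\ell(v)\gets-\ell_{\max}(v)$; otherwise $\ell(v)\gets\max\{\ell(v)-1,1\}$. For given levels, let $I$ be the set of all vertices $v$ with $\ell(v)=-\ell_{\max}(v)$ and $\ell(u)=\ell_{\max}(u)$ for every neighbor $u$ of $v$. The levels form a *stable MIS* if $I$ is a maximal independent set of $G$, every vertex lies in $I$ or has a neighbor in $I$, and with probability $1$ the levels never change again. **Theorem.** For all real constants $c_1\ge 15$, $c_2>0$ and $a>0$ there is a constant $C>0$ such that the following holds for every finite graph $G$ with $n$ vertices and maximum degree $\Delta$. Suppose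 that all vertices have the same cap $\ell_{\max}(v)=\ell_{\max}$ with $$\log_2 \max\{\Delta,1\}+c_1\;\le\;\ell_{\max}\;\le\; c_2\log_2 n .$$ Then, from any initial configuration of levels in $\{-\ell_{\max},\dots,\ell_{\max}\}$, the algorithm has reached a stable MIS after $\lfloor C\log_2 n\rfloor$ rounds with probability at least $1-n^{-a}$. -/

import Mathlib

open scoped NNReal ENNReal

namespace BeepingMIS

noncomputable section

open Classical in
/-- The probability with which a vertex of level `l` and cap `m` beeps:
`min {2 ^ (-l), 1}` when `l < m`, and `0` when `l = m`. -/
def beepProb (m : ℕ) (l : ℤ) : ℝ≥0 :=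
  if l < (m : ℤ) then min ((2 : ℝ≥0) ^ (-l)) 1 else 0

theorem beepProb_le_one (m : ℕ) (l : ℤ) : beepProb m l ≤ 1 := by
  unfold beepProb
  split_ifs
  · exact min_le_right _ _
  · exact zero_le_one

variable {V : Type*}

/-- `l` assigns to each vertex `v` a level in `{-lmax v, ..., lmax v}`. -/
def IsConfiguration (lmax : V → ℕ) (l : V → ℤ) : Prop :=
  ∀ v, -(lmax v : ℤ) ≤ l v ∧ l v ≤ (lmax v : ℤ)

/-- Vertex `v` receives a signal when `b` tells which vertices beep. -/
def Hears (G : SimpleGraph V) (b : V → Bool) (v : V) : Prop :=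
  ∃ u, G.Adj v u ∧ b u = true

open Classical in
/-- The update of all levels at the end of a round in which exactly the vertices `v` with
`b v = true` beep. -/
def update (G : SimpleGraph V) (lmax : V → ℕ) (l : V → ℤ) (b : V → Bool) : V → ℤ :=
  fun v =>
    if Hears G b v then min (l v + 1) (lmax v)
    else if b v = true then -(lmax v : ℤ)
    else max (l v - 1) 1

open Classical in
/-- The beeps of one round started with levels `l`: the vertices beep independently of each
other, vertex `v` with probability `beepProb (lmax v) (l v)`. -/
def beeps [Fintype V] (lmax : V → ℕ) (l : V → ℤ) : PMF (V → Bool) :=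
  PMF.ofFintype
    (fun b => ((∏ v, (if b v = true then beepProb (lmax v) (l v)
      else 1 - beepProb (lmax v) (l v)) : ℝ≥0) : ℝ≥0∞))
    (by
      have h := Finset.prod_univ_sum (fun _ : V => (Finset.univ : Finset Bool))
        (fun v c => if c = true then beepProb (lmax v) (l v)
          else 1 - beepProb (lmax v) (l v))
      rw [Fintype.piFinset_univ] at h
      rw [← ENNReal.ofNNReal_finsetSum, ← h]
      simp [beepProb_le_one])

/-- One round of the algorithm: the law of the levels at its end. -/
def step [Fintype V] (G : SimpleGraph V) (lmax : V → ℕ) (l : V → ℤ) : PMF (V → ℤ) :=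
  (beeps lmax l).map (update G lmax l)

/-- The law of the levels after `T` rounds, from the initial levels `l`. -/
def run [Fintype V] (G : SimpleGraph V) (lmax : V → ℕ) : ℕ → (V → ℤ) → PMF (V → ℤ)
  | 0, l => PMF.pure l
  | T + 1, l => (run G lmax T l).bind (step G lmax)

/-- The set computed by the algorithm: the vertices of level `-lmax v` all of whose neighbors
are at their maximal level. -/
def misSet (G : SimpleGraph V) (lmax : V → ℕ) (l : V → ℤ) : Set V :=
  {v | l v = -(lmax v : ℤ) ∧ ∀ u, G.Adj v u → l u = (lmax u : ℤ)}

/-- The stable vertices: those of the computed set and their neighbors. -/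
def stableSet (G : SimpleGraph V) (lmax : V → ℕ) (l : V → ℤ) : Set V :=
  {v | v ∈ misSet G lmax l ∨ ∃ u ∈ misSet G lmax l, G.Adj u v}

/-- The levels `l` form a stable MIS: the computed set is a maximal independent set, every vertex
is stable, and with probability one the levels never change again. -/
def IsStableMIS [Fintype V] (G : SimpleGraph V) (lmax : V → ℕ) (l : V → ℤ) : Prop :=
  Maximal G.IsIndepSet (misSet G lmax l) ∧
  stableSet G lmax l = Set.univ ∧
  ∀ k : ℕ, run G lmax k l = PMF.pure l

end

end BeepingMIS

/-!
A vertex that beeps alone drops to its bottom level, keeps beeping while its neighbors climb to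
their caps, and so ends up in the computed set: it suffices that after `O(log n)` rounds every
closed neighborhood contains such a vertex. Fix `v`, and call the expected number of beeping
neighbors of `v` its load. If the neighbors of `v` whose own neighborhoods are silent with constant
probability have a constant share of beeps, then one of them beeps alone with constant probability,
because silences of overlapping neighborhoods are positively correlated. Otherwise most neighbors
hear a beep and halve their rates, so the load contracts in expectation; once it is small, either
`v` is at level one and beeps alone with constant probability, or its level falls. The potential
`(1 + load) * 1.1 ^ level` thus contracts in expectation, or `v` is covered with constant
probability `γ` while the potential grows at most by a factor of 3. By concavity, its power with
exponent `γ / 4`, set to zero once `v` is covered, contracts in every round, and a union bound over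
`v` finishes the proof.
-/

namespace BeepingMIS

open Finset

section Probability

variable {α β : Type*}

/-- The probability of the event `S` under `μ`, as a real number. -/
noncomputable def prob (μ : PMF α) (S : Set α) : ℝ := (μ.toOuterMeasure S).toReal

/-- The expectation under a distribution `μ` on a finite type, as a linear functional on the
real-valued functions. -/
noncomputable def expect [Fintype α] (μ : PMF α) : (α → ℝ) →ₗ[ℝ] ℝ :=
  ∑ a, (μ a).toReal • LinearMap.proj a

theorem toOuterMeasure_ne_top (μ : PMF α) (S : Set α) : μ.toOuterMeasure S ≠ ⊤ := by
  let : MeasurableSpace α := ⊤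
  rw [← μ.toMeasure_apply_eq_toOuterMeasure]
  exact MeasureTheory.measure_ne_top _ _

theorem prob_nonneg (μ : PMF α) (S : Set α) : 0 ≤ prob μ S := ENNReal.toReal_nonneg

theorem prob_mono {μ : PMF α} {S T : Set α} (h : ∀ a ∈ μ.support, a ∈ S → a ∈ T) :
    prob μ S ≤ prob μ T :=
  ENNReal.toReal_mono (toOuterMeasure_ne_top μ T)
    (μ.toOuterMeasure_mono fun a ha => h a ha.2 ha.1)

theorem prob_eq_one {μ : PMF α} {S : Set α} (h : μ.support ⊆ S) : prob μ S = 1 := by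
  rw [prob, (μ.toOuterMeasure_apply_eq_one_iff S).2 h, ENNReal.toReal_one]

theorem prob_eq_zero {μ : PMF α} {S : Set α} (h : Disjoint μ.support S) : prob μ S = 0 := by
  rw [prob, (μ.toOuterMeasure_apply_eq_zero_iff S).2 h, ENNReal.toReal_zero]

theorem prob_union (μ : PMF α) {S T : Set α} (h : Disjoint S T) :
    prob μ (S ∪ T) = prob μ S + prob μ T := by
  let : MeasurableSpace α := ⊤
  simp only [prob, ← μ.toMeasure_apply_eq_toOuterMeasure]
  exact MeasureTheory.measureReal_union h trivial

theorem prob_compl (μ : PMF α) (S : Set α) : prob μ Sᶜ = 1 - prob μ S := by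
  rw [eq_sub_iff_add_eq', ← prob_union μ disjoint_compl_right, Set.union_compl_self,
    prob_eq_one (Set.subset_univ _)]

theorem prob_le_one (μ : PMF α) (S : Set α) : prob μ S ≤ 1 := by
  rw [← sub_nonneg, ← prob_compl]
  exact prob_nonneg μ Sᶜ

theorem prob_biUnion_le {ι : Type*} (μ : PMF α) (s : Finset ι) (S : ι → Set α) :
    prob μ (⋃ i ∈ s, S i) ≤ ∑ i ∈ s, prob μ (S i) := by
  have h : ∑ i ∈ s, μ.toOuterMeasure (S i) ≠ ⊤ :=
    ENNReal.sum_ne_top.2 fun i _ => toOuterMeasure_ne_top μ (S i)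
  simpa only [prob, ENNReal.toReal_sum fun i _ => toOuterMeasure_ne_top μ (S i)] using
    ENNReal.toReal_mono h (MeasureTheory.measure_biUnion_finset_le s S)

theorem prob_le_one_sub_of_le_prob {μ : PMF α} {S T : Set α} {c : ℝ} (hT : c ≤ prob μ T)
    (h : ∀ a ∈ μ.support, a ∈ T → a ∉ S) : prob μ S ≤ 1 - c :=
  calc prob μ S ≤ prob μ Tᶜ := prob_mono fun a ha haS haT => h a ha haT haS
    _ = 1 - prob μ T := prob_compl μ T
    _ ≤ 1 - c := sub_le_sub_left hT 1

theorem prob_bind_le {μ : PMF α} {f : α → PMF β} {S : Set β} {c : ℝ}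
    (h : ∀ a ∈ μ.support, prob (f a) S ≤ c) : prob (μ.bind f) S ≤ c := by
  obtain ⟨a₀, ha₀⟩ := μ.support_nonempty
  refine ENNReal.toReal_le_of_le_ofReal ((prob_nonneg _ S).trans (h a₀ ha₀)) ?_
  calc (μ.bind f).toOuterMeasure S = ∑' a, μ a * (f a).toOuterMeasure S :=
        PMF.toOuterMeasure_bind_apply _ _ _
    _ ≤ ∑' a, μ a * ENNReal.ofReal c := by
        refine ENNReal.tsum_le_tsum fun a => ?_
        by_cases ha : a ∈ μ.support
        · gcongr
          exact (ENNReal.le_ofReal_iff_toReal_le (toOuterMeasure_ne_top _ S)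
            ((prob_nonneg _ S).trans (h a ha))).2 (h a ha)
        · simp [(μ.apply_eq_zero_iff a).2 ha]
    _ = ENNReal.ofReal c := by rw [ENNReal.tsum_mul_right, μ.tsum_coe, one_mul]

theorem prob_bind_le_prob {μ : PMF α} {f : α → PMF β} {A : Set α} {S : Set β}
    (h : ∀ a ∈ μ.support, a ∉ A → Disjoint (f a).support S) :
    prob (μ.bind f) S ≤ prob μ A := by
  refine ENNReal.toReal_mono (toOuterMeasure_ne_top μ A) ?_
  rw [PMF.toOuterMeasure_bind_apply, PMF.toOuterMeasure_apply]
  refine ENNReal.tsum_le_tsum fun a => ?_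
  by_cases haA : a ∈ A
  · rw [Set.indicator_of_mem haA, ← PMF.toOuterMeasure_apply_singleton]
    exact mul_le_of_le_one_right' <| by
      let : MeasurableSpace β := ⊤
      rw [← PMF.toMeasure_apply_eq_toOuterMeasure]
      exact MeasureTheory.prob_le_one
  · by_cases ha : a ∈ μ.support
    · simp [(PMF.toOuterMeasure_apply_eq_zero_iff _ _).2 (h a ha haA)]
    · simp [(μ.apply_eq_zero_iff a).2 ha]

theorem eq_pure_of_support_subset {μ : PMF α} {a : α} (h : μ.support ⊆ {a}) :
    μ = PMF.pure a := by
  have ha : μ.support = {a} := μ.support_nonempty.subset_singleton_iff.1 h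
  ext x
  by_cases hx : x = a
  · simp [hx, (μ.apply_eq_one_iff a).2 ha]
  · simp [hx, (μ.apply_eq_zero_iff x).2 (by simp [ha, hx])]

section Expectation

variable [Fintype α] {μ : PMF α}

theorem expect_apply (μ : PMF α) (F : α → ℝ) : expect μ F = ∑ a, (μ a).toReal * F a := by
  simp [expect]

theorem expect_const (μ : PMF α) (c : ℝ) : expect μ (fun _ => c) = c := by
  have h : ∑ a, μ a = 1 := (tsum_fintype _).symm.trans μ.tsum_coe
  rw [expect_apply, ← sum_mul, ← ENNReal.toReal_sum fun a _ => μ.apply_ne_top a, h,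
    ENNReal.toReal_one, one_mul]

theorem expect_mono {F H : α → ℝ} (h : ∀ a ∈ μ.support, F a ≤ H a) :
    expect μ F ≤ expect μ H := by
  simp only [expect_apply]
  refine sum_le_sum fun a _ => ?_
  by_cases ha : a ∈ μ.support
  · exact mul_le_mul_of_nonneg_left (h a ha) ENNReal.toReal_nonneg
  · simp [(μ.apply_eq_zero_iff a).2 ha]

theorem expect_indicator_le {E : Set α} {F H : α → ℝ} (hH : ∀ a, 0 ≤ H a)
    (h : ∀ a ∈ μ.support, a ∈ E → F a ≤ H a) : expect μ (E.indicator F) ≤ expect μ H :=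
  expect_mono fun a ha => Set.indicator_apply_le' (h a ha) fun _ => hH a

theorem prob_eq_expect_indicator (μ : PMF α) (S : Set α) :
    prob μ S = expect μ (S.indicator 1) := by
  rw [prob, PMF.toOuterMeasure_apply_fintype, expect_apply,
    ENNReal.toReal_sum fun a _ => ne_top_of_le_ne_top (μ.apply_ne_top a)
      (Set.indicator_le_self S μ a)]
  refine sum_congr rfl fun a _ => ?_
  by_cases ha : a ∈ S <;> simp [ha]

theorem prob_bind_eq_expect (μ : PMF α) (f : α → PMF β) (S : Set β) :
    prob (μ.bind f) S = expect μ fun a => prob (f a) S := by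
  simp only [prob, expect_apply, PMF.toOuterMeasure_bind_apply, tsum_fintype,
    ← ENNReal.toReal_mul]
  exact ENNReal.toReal_sum fun a _ =>
    ENNReal.mul_ne_top (μ.apply_ne_top a) (toOuterMeasure_ne_top _ _)

theorem expect_affine (μ : PMF α) (F : α → ℝ) (E : Set α) (x y z : ℝ) :
    expect μ (fun a => x * F a + y + z * E.indicator 1 a) =
      x * expect μ F + y + z * prob μ E := by
  have h : (fun a => x * F a + y + z * E.indicator 1 a) =
      x • F + (fun _ => y) + z • E.indicator 1 := rfl
  rw [h, map_add, map_add, map_smul, map_smul, expect_const, ← prob_eq_expect_indicator]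
  rfl

theorem expect_sum_add_mul_indicator {ι : Type*} (μ : PMF α) (s : Finset ι) (x y : ι → ℝ)
    (E : ι → Set α) :
    expect μ (fun a => ∑ i ∈ s, (x i + y i * (E i).indicator 1 a)) =
      ∑ i ∈ s, (x i + y i * prob μ (E i)) := by
  have h : (fun a => ∑ i ∈ s, (x i + y i * (E i).indicator 1 a)) =
      ∑ i ∈ s, ((fun _ => x i) + y i • (E i).indicator 1) := by
    ext a
    simp
  rw [h, map_sum]
  refine sum_congr rfl fun i _ => ?_
  rw [map_add, map_smul, expect_const, ← prob_eq_expect_indicator, smul_eq_mul]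

theorem rpow_le_tangent {x y s : ℝ} (hx : 0 ≤ x) (hy : 0 < y) (hs₀ : 0 ≤ s) (hs₁ : s ≤ 1) :
    x ^ s ≤ (1 - s + s * (x / y)) * y ^ s := by
  have hxy : 0 ≤ x / y := div_nonneg hx hy.le
  have h := rpow_one_add_le_one_add_mul_self (s := x / y - 1) (by linarith) hs₀ hs₁
  rw [add_sub_cancel, Real.div_rpow hx hy.le, div_le_iff₀ (Real.rpow_pos_of_pos hy s)] at h
  exact h.trans_eq (by ring)

variable {E : Set α} {X : α → ℝ} {y s : ℝ}

theorem expect_indicator_rpow_le_of_expect_le {β : ℝ} (hX : ∀ a, 0 ≤ X a) (hy : 0 < y)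
    (hs₀ : 0 ≤ s) (hs₁ : s ≤ 1) (h : expect μ (E.indicator X) ≤ (1 - β) * y) :
    expect μ (E.indicator fun a => X a ^ s) ≤ (1 - s * β) * y ^ s := by
  have : 0 ≤ 1 - s := sub_nonneg.2 hs₁
  calc expect μ (E.indicator fun a => X a ^ s)
      ≤ expect μ fun a => s / y * y ^ s * E.indicator X a + (1 - s) * y ^ s + 0 * E.indicator 1 a :=
        expect_indicator_le
          (fun a => by
            have : 0 ≤ E.indicator X a := Set.indicator_nonneg (fun a _ => hX a) a
            simp only [zero_mul, add_zero]
            positivity)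
          fun a _ haE => (rpow_le_tangent (hX a) hy hs₀ hs₁).trans_eq (by
            rw [Set.indicator_of_mem haE]
            ring)
    _ = (1 - s + s / y * expect μ (E.indicator X)) * y ^ s := by
        rw [expect_affine]
        ring
    _ ≤ (1 - s + s / y * ((1 - β) * y)) * y ^ s := by gcongr
    _ = (1 - s * β) * y ^ s := by
        field_simp
        ring

theorem expect_indicator_rpow_le_of_prob_le {γ K : ℝ} (hX : ∀ a, 0 ≤ X a) (hy : 0 < y)
    (hs₀ : 0 ≤ s) (hs₁ : s ≤ 1) (hK : 1 ≤ K) (hXK : ∀ a ∈ μ.support, a ∈ E → X a ≤ K * y)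
    (h : prob μ E ≤ 1 - γ) :
    expect μ (E.indicator fun a => X a ^ s) ≤ (1 - γ) * (1 + s * (K - 1)) * y ^ s := by
  have : 0 ≤ 1 + s * (K - 1) := by
    have := mul_nonneg hs₀ (sub_nonneg.2 hK)
    linarith
  have hXs : ∀ a ∈ μ.support, a ∈ E → X a ^ s ≤ (1 + s * (K - 1)) * y ^ s := fun a ha haE =>
    (rpow_le_tangent (hX a) hy hs₀ hs₁).trans <| by
      have := mul_le_mul_of_nonneg_left ((div_le_iff₀ hy).2 (hXK a ha haE)) hs₀
      exact mul_le_mul_of_nonneg_right (by linarith) (Real.rpow_nonneg hy.le s)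
  calc expect μ (E.indicator fun a => X a ^ s)
      ≤ expect μ (((1 + s * (K - 1)) * y ^ s) • E.indicator 1) :=
        expect_mono fun a ha => by
          by_cases haE : a ∈ E
          · simpa [haE] using hXs a ha haE
          · simp [haE]
    _ = prob μ E * ((1 + s * (K - 1)) * y ^ s) := by
        rw [map_smul, ← prob_eq_expect_indicator, smul_eq_mul, mul_comm]
    _ ≤ (1 - γ) * ((1 + s * (K - 1)) * y ^ s) := by gcongr
    _ = (1 - γ) * (1 + s * (K - 1)) * y ^ s := (mul_assoc _ _ _).symm

end Expectation

end Probability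

section Coins

variable {V : Type*} [Fintype V] {μ : PMF (V → Bool)} {p : V → ℝ}

/-- The outcomes of a family of independent coins, the coin `v` showing `true` with probability
`p v`. -/
def IndepCoins (μ : PMF (V → Bool)) (p : V → ℝ) : Prop :=
  ∀ b, (μ b).toReal = ∏ v, if b v = true then p v else 1 - p v

namespace IndepCoins

theorem expect_prod [DecidableEq V] (hμ : IndepCoins μ p) (g : V → Bool → ℝ) :
    expect μ (fun b => ∏ v, g v (b v)) = ∏ v, (p v * g v true + (1 - p v) * g v false) := by
  have h := prod_univ_sum (fun _ : V => (univ : Finset Bool))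
    fun v c => (if c = true then p v else 1 - p v) * g v c
  simp only [Fintype.piFinset_univ, Fintype.sum_bool, if_true, Bool.false_eq_true, if_false] at h
  rw [h, expect_apply]
  exact sum_congr rfl fun b _ => by rw [hμ b, prod_mul_distrib]

theorem prob_pattern (hμ : IndepCoins μ p) {A S : Finset V} (hAS : Disjoint A S) :
    prob μ {b | (∀ u ∈ A, b u = true) ∧ ∀ u ∈ S, b u = false} =
      (∏ u ∈ A, p u) * ∏ u ∈ S, (1 - p u) := by
  classical
  have hind : Set.indicator {b : V → Bool | (∀ u ∈ A, b u = true) ∧ ∀ u ∈ S, b u = false} 1 =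
      fun b => ∏ v, ((if v ∈ A then if b v = true then (1 : ℝ) else 0 else 1) *
        if v ∈ S then if b v = false then 1 else 0 else 1) := by
    ext b
    rw [prod_mul_distrib]
    simp only [prod_ite_mem, univ_inter, prod_ite_zero, prod_const_one, Set.indicator_apply]
    split_ifs <;> simp_all
  rw [prob_eq_expect_indicator, hind, hμ.expect_prod fun v c =>
      (if v ∈ A then if c = true then 1 else 0 else 1) *
        if v ∈ S then if c = false then 1 else 0 else 1,
    ← univ_inter A, ← univ_inter S, ← prod_ite_mem, ← prod_ite_mem, ← prod_mul_distrib]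
  refine prod_congr rfl fun v _ => ?_
  by_cases hA : v ∈ A
  · simp [hA, Finset.disjoint_left.1 hAS hA]
  · by_cases hS : v ∈ S <;> simp [hA, hS]

theorem prob_forall_false (hμ : IndepCoins μ p) (S : Finset V) :
    prob μ {b | ∀ u ∈ S, b u = false} = ∏ u ∈ S, (1 - p u) := by
  simpa using hμ.prob_pattern (disjoint_empty_left S)

theorem prob_true_and_forall_false (hμ : IndepCoins μ p) {v : V} {S : Finset V} (hv : v ∉ S) :
    prob μ {b | b v = true ∧ ∀ u ∈ S, b u = false} = p v * ∏ u ∈ S, (1 - p u) := by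
  simpa using hμ.prob_pattern (disjoint_singleton_left.2 hv)

theorem prob_true (hμ : IndepCoins μ p) (v : V) : prob μ {b | b v = true} = p v := by
  simpa using hμ.prob_true_and_forall_false (notMem_empty v)

theorem nonneg (hμ : IndepCoins μ p) (v : V) : 0 ≤ p v :=
  (prob_nonneg μ _).trans_eq (hμ.prob_true v)

theorem eq_true_of_mem_support (hμ : IndepCoins μ p) {b : V → Bool} (hb : b ∈ μ.support) {v : V}
    (hv : p v = 1) : b v = true := by
  by_contra h
  have hb₀ : (μ b).toReal = 0 := (hμ b).trans (prod_eq_zero (mem_univ v) (by simp [h, hv]))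
  exact ENNReal.toReal_ne_zero.2 ⟨hb, μ.apply_ne_top b⟩ hb₀

theorem eq_false_of_mem_support (hμ : IndepCoins μ p) {b : V → Bool} (hb : b ∈ μ.support) {v : V}
    (hv : p v = 0) : b v = false := by
  by_contra h
  have hb₀ : (μ b).toReal = 0 := (hμ b).trans (prod_eq_zero (mem_univ v) (by simp [h, hv]))
  exact ENNReal.toReal_ne_zero.2 ⟨hb, μ.apply_ne_top b⟩ hb₀

theorem prob_forall_false_le_inv (hμ : IndepCoins μ p) (S : Finset V) :
    prob μ {b | ∀ u ∈ S, b u = false} ≤ (1 + ∑ u ∈ S, p u)⁻¹ :=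
  calc prob μ {b | ∀ u ∈ S, b u = false} = ∏ u ∈ S, (1 - p u) := hμ.prob_forall_false S
    _ ≤ ∏ u ∈ S, Real.exp (-p u) := prod_le_prod
        (fun u _ => sub_nonneg.2 ((hμ.prob_true u).symm.trans_le (prob_le_one μ _)))
        fun u _ => Real.one_sub_le_exp_neg (p u)
    _ = (Real.exp (∑ u ∈ S, p u))⁻¹ := by
        rw [← Real.exp_sum, sum_neg_distrib, Real.exp_neg]
    _ ≤ (1 + ∑ u ∈ S, p u)⁻¹ := by
        have : 0 ≤ ∑ u ∈ S, p u := sum_nonneg fun u _ => hμ.nonneg u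
        gcongr
        exact (add_comm _ _).trans_le (Real.add_one_le_exp _)

theorem mul_prob_forall_false_le [DecidableEq V] (hμ : IndepCoins μ p) (S T : Finset V) :
    prob μ {b | ∀ u ∈ S, b u = false} * prob μ {b | ∀ u ∈ T, b u = false} ≤
      prob μ {b | ∀ u ∈ S ∪ T, b u = false} := by
  simp only [hμ.prob_forall_false]
  rw [← prod_union_inter, ← hμ.prob_forall_false (S ∪ T), ← hμ.prob_forall_false (S ∩ T)]
  exact mul_le_of_le_one_right (prob_nonneg _ _) (prob_le_one _ _)

-- Adding a vertex `a` to `A` gains at least the event that `a` beeps while its neighborhood and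
-- the rest of `A` are silent; by positive correlation of silences its probability is at least
-- `η` times the increase of the probability that some vertex of `A` beeps.
theorem le_prob_exists_alone (hμ : IndepCoins μ p) {N : V → Finset V} (hN : ∀ u, u ∉ N u)
    {η : ℝ} (A : Finset V) (hA : ∀ u ∈ A, η ≤ prob μ {b | ∀ w ∈ N u, b w = false}) :
    η * (1 - prob μ {b | ∀ u ∈ A, b u = false}) ≤
      prob μ {b | ∃ u ∈ A, b u = true ∧ ∀ w ∈ N u, b w = false} := by
  classical
  induction A using Finset.induction_on with
  | empty => simp [prob_eq_one, prob_eq_zero]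
  | insert a A ha ih =>
    have hdisj : Disjoint {b : V → Bool | b a = true ∧ ∀ u ∈ N a ∪ A, b u = false}
        {b | ∃ u ∈ A, b u = true ∧ ∀ w ∈ N u, b w = false} :=
      Set.disjoint_left.2 fun b ⟨_, hb⟩ ⟨u, hu, hbu, _⟩ => by
        simp [hb u (mem_union_right _ hu)] at hbu
    have hstep : η * (p a * prob μ {b | ∀ u ∈ A, b u = false}) ≤
        prob μ {b | b a = true ∧ ∀ u ∈ N a ∪ A, b u = false} := by
      rw [hμ.prob_true_and_forall_false (by simp [hN a, ha]), mul_left_comm,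
        ← hμ.prob_forall_false]
      exact mul_le_mul_of_nonneg_left ((mul_le_mul_of_nonneg_right (hA a (mem_insert_self a A))
        (prob_nonneg _ _)).trans (hμ.mul_prob_forall_false_le _ _)) (hμ.nonneg a)
    calc η * (1 - prob μ {b | ∀ u ∈ insert a A, b u = false})
        = η * (p a * prob μ {b | ∀ u ∈ A, b u = false}) +
          η * (1 - prob μ {b | ∀ u ∈ A, b u = false}) := by
          simp only [hμ.prob_forall_false, prod_insert ha]
          ring
      _ ≤ prob μ {b | b a = true ∧ ∀ u ∈ N a ∪ A, b u = false} +
          prob μ {b | ∃ u ∈ A, b u = true ∧ ∀ w ∈ N u, b w = false} :=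
          add_le_add hstep (ih fun u hu => hA u (mem_insert_of_mem hu))
      _ = _ := (prob_union μ hdisj).symm
      _ ≤ _ := prob_mono <| by
          rintro b - (h | ⟨u, hu, h⟩)
          · exact ⟨a, mem_insert_self a A, h.1, fun w hw => h.2 w (mem_union_left _ hw)⟩
          · exact ⟨u, mem_insert_of_mem hu, h⟩

end IndepCoins

end Coins

section Levels

variable {V : Type*} {G : SimpleGraph V} {lmax : V → ℕ} {l : V → ℤ} {b : V → Bool} {v w : V}
  {m k : ℕ} {x : ℤ}

theorem beepProb_self (m : ℕ) : beepProb m m = 0 := by simp [beepProb]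

theorem beepProb_of_nonpos (hx : x ≤ 0) (hm : 0 < m) : beepProb m x = 1 := by
  have hxm : x < m := by omega
  rw [beepProb, if_pos hxm, min_eq_right (one_le_zpow₀ one_le_two (by omega))]

theorem beepProb_of_nonneg (hx : 0 ≤ x) (hxm : x < m) : beepProb m x = 2 ^ (-x) := by
  rw [beepProb, if_pos hxm, min_eq_left (zpow_le_one_of_nonpos₀ one_le_two (by omega))]

theorem two_mul_beepProb_min_add_one_le (hx : 0 ≤ x) :
    2 * beepProb m (min (x + 1) m) ≤ beepProb m x := by
  rcases lt_or_ge (x + 1) m with h | h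
  · rw [min_eq_left h.le, beepProb_of_nonneg (by omega) h, beepProb_of_nonneg hx (by omega),
      ← zpow_one_add₀ two_ne_zero]
    exact le_of_eq (by ring_nf)
  · simp [min_eq_right h, beepProb_self]

theorem beepProb_max_sub_one_le (hm : 2 ≤ m) (hx : 1 ≤ x) (hxm : x ≤ m) :
    beepProb m (max (x - 1) 1) ≤ 2 * beepProb m x + 2 ^ (1 - (m : ℤ)) := by
  rcases hxm.eq_or_lt with rfl | h
  · rw [max_eq_left (by omega), beepProb_of_nonneg (by omega) (by omega), neg_sub]
    exact le_add_self
  rw [beepProb_of_nonneg (by omega) h, ← zpow_one_add₀ two_ne_zero,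
    beepProb_of_nonneg (by omega) (by omega)]
  exact (zpow_le_zpow_right₀ one_le_two (by omega)).trans le_self_add

theorem update_of_hears (h : Hears G b v) :
    update G lmax l b v = min (l v + 1) (lmax v) := by simp [update, h]

theorem update_of_silent (h : ¬Hears G b v) (hv : b v = false) :
    update G lmax l b v = max (l v - 1) 1 := by simp [update, h, hv]

theorem update_le_add_one (hv : 1 ≤ l v) : update G lmax l b v ≤ l v + 1 := by
  simp only [update]
  split_ifs <;> omega

theorem IsConfiguration.update (hl : IsConfiguration lmax l) (hpos : ∀ v, 0 < lmax v) :
    IsConfiguration lmax (update G lmax l b) := fun v => by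
  have := hl v
  have := hpos v
  simp only [BeepingMIS.update]
  split_ifs <;> omega

/-- The vertex `v` beeps while all its neighbors are silent. -/
def BeepsAlone (G : SimpleGraph V) (b : V → Bool) (v : V) : Prop :=
  b v = true ∧ ¬Hears G b v

theorem BeepsAlone.update_eq (h : BeepsAlone G b v) :
    BeepingMIS.update G lmax l b v = -(lmax v : ℤ) := by simp [update, h.1, h.2]

theorem BeepsAlone.eq_false_of_adj (h : BeepsAlone G b v) (hw : G.Adj v w) : b w = false :=
  Bool.eq_false_iff.2 fun hbw => h.2 ⟨w, hw, hbw⟩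

/-- The beeps `b` respect the rules whose outcome at levels `l` is certain: nonpositive levels
beep and maximal levels are silent. -/
def Admissible (lmax : V → ℕ) (l : V → ℤ) (b : V → Bool) : Prop :=
  (∀ v, l v ≤ 0 → b v = true) ∧ ∀ v, l v = lmax v → b v = false

/-- The vertex `w` is bound to enter the computed set in at most `k + 1` rounds: its level stays
negative for `k` more rounds, which is long enough to push all its neighbors to their caps. -/
def Dominates (G : SimpleGraph V) (lmax : V → ℕ) (k : ℕ) (w : V) (l : V → ℤ) : Prop :=
  l w < -(k : ℤ) ∧ ∀ u, G.Adj w u → (lmax u : ℤ) ≤ l u + k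

theorem BeepsAlone.dominates_update (h : BeepsAlone G b w) (hpos : ∀ v, 0 < lmax v)
    (hcap : ∀ u v, G.Adj u v → lmax u = lmax v) (hb : Admissible lmax l b) :
    Dominates G lmax (lmax w - 1) w (update G lmax l b) := by
  have := hpos w
  refine ⟨by rw [h.update_eq]; omega, fun u hu => ?_⟩
  have hlu : 0 < l u := by
    by_contra hlu
    simpa [h.eq_false_of_adj hu] using hb.1 u (not_lt.1 hlu)
  have := hcap w u hu
  rw [update_of_hears ⟨w, hu.symm, h.1⟩]
  omega

theorem Dominates.beeps (h : Dominates G lmax k w l) (hb : Admissible lmax l b) : b w = true :=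
  hb.1 w (by have := h.1; omega)

theorem Dominates.beepsAlone (h : Dominates G lmax 0 w l) (hl : IsConfiguration lmax l)
    (hb : Admissible lmax l b) : BeepsAlone G b w := by
  refine ⟨h.beeps hb, fun ⟨u, hu, hbu⟩ => ?_⟩
  have hlu : l u = lmax u := le_antisymm (hl u).2 (by simpa using h.2 u hu)
  simp [hb.2 u hlu] at hbu

theorem Dominates.update (h : Dominates G lmax k w l) (hl : IsConfiguration lmax l)
    (hb : Admissible lmax l b) : Dominates G lmax (k - 1) w (update G lmax l b) := by
  obtain ⟨hw, hnbr⟩ := id h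
  refine ⟨?_, fun u hu => ?_⟩
  · have := (hl w).1
    by_cases hhears : Hears G b w
    · obtain rfl | hk := k.eq_zero_or_pos
      · exact absurd hhears (h.beepsAlone hl hb).2
      · rw [update_of_hears hhears]
        omega
    · rw [BeepsAlone.update_eq ⟨h.beeps hb, hhears⟩]
      omega
  · have := hnbr u hu
    rw [update_of_hears ⟨w, hu.symm, h.beeps hb⟩]
    omega

theorem Dominates.lt_lmax (h : Dominates G lmax k w l) (hl : IsConfiguration lmax l) :
    k < lmax w := by
  have := (hl w).1
  have := h.1
  omega

theorem Dominates.update_mem_misSet (h : Dominates G lmax 0 w l) (hl : IsConfiguration lmax l)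
    (hb : Admissible lmax l b) : w ∈ misSet G lmax (BeepingMIS.update G lmax l b) := by
  refine ⟨(h.beepsAlone hl hb).update_eq, fun u hu => ?_⟩
  have := h.2 u hu
  rw [update_of_hears ⟨w, hu.symm, h.beeps hb⟩]
  omega

/-- The vertex `w` is bound to enter the computed set. -/
def Wins (G : SimpleGraph V) (lmax : V → ℕ) (w : V) (l : V → ℤ) : Prop :=
  ∃ k, Dominates G lmax k w l

theorem Wins.update (h : Wins G lmax w l) (hl : IsConfiguration lmax l)
    (hb : Admissible lmax l b) : Wins G lmax w (update G lmax l b) :=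
  h.elim fun _ hk => ⟨_, hk.update hl hb⟩

/-- The vertex `v` or one of its neighbors is bound to enter the computed set. -/
def Covered (G : SimpleGraph V) (lmax : V → ℕ) (l : V → ℤ) (v : V) : Prop :=
  ∃ w, (w = v ∨ G.Adj v w) ∧ Wins G lmax w l

theorem Covered.update (h : Covered G lmax l v) (hl : IsConfiguration lmax l)
    (hb : Admissible lmax l b) : Covered G lmax (update G lmax l b) v :=
  h.elim fun w hw => ⟨w, hw.1, hw.2.update hl hb⟩

/-- The beeps of a round in which neither `v` nor any of its neighbors beeps alone. -/
def noneAlone (G : SimpleGraph V) (v : V) : Set (V → Bool) :=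
  {b | ∀ w, w = v ∨ G.Adj v w → ¬BeepsAlone G b w}

theorem mem_noneAlone_of_not_covered_update (h : ¬Covered G lmax (update G lmax l b) v)
    (hpos : ∀ v, 0 < lmax v) (hcap : ∀ u v, G.Adj u v → lmax u = lmax v)
    (hb : Admissible lmax l b) : b ∈ noneAlone G v :=
  fun w hw halone => h ⟨w, hw, _, halone.dominates_update hpos hcap hb⟩

/-- The levels after `k` rounds, as far as they are certain: a vertex that has not beeped alone
has climbed from its bottom level by one in each round, and stays positive from then on. -/
def Settled (G : SimpleGraph V) (lmax : V → ℕ) (k : ℕ) (l : V → ℤ) : Prop :=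
  ∀ w, Wins G lmax w l ∨ min (-(lmax w : ℤ) + k) 1 ≤ l w

theorem IsConfiguration.settled_zero (hl : IsConfiguration lmax l) : Settled G lmax 0 l :=
  fun w => Or.inr (by have := (hl w).1; omega)

theorem Settled.anti {j : ℕ} (h : Settled G lmax k l) (hjk : j ≤ k) : Settled G lmax j l :=
  fun w => (h w).imp_right fun hw => by omega

theorem Settled.update (h : Settled G lmax k l) (hl : IsConfiguration lmax l)
    (hpos : ∀ v, 0 < lmax v) (hcap : ∀ u v, G.Adj u v → lmax u = lmax v)
    (hb : Admissible lmax l b) : Settled G lmax (k + 1) (update G lmax l b) := by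
  intro w
  rcases h w with hw | hw
  · exact Or.inl (hw.update hl hb)
  by_cases hhears : Hears G b w
  · have := hpos w
    right
    rw [update_of_hears hhears]
    omega
  by_cases hbw : b w = true
  · exact Or.inl ⟨_, BeepsAlone.dominates_update ⟨hbw, hhears⟩ hpos hcap hb⟩
  · right
    rw [update_of_silent hhears (Bool.eq_false_iff.2 hbw)]
    omega

theorem Settled.one_le (h : Settled G lmax k l) (hk : ∀ v, lmax v + 1 ≤ k)
    (hv : ¬Covered G lmax l v) (hw : w = v ∨ G.Adj v w) : 1 ≤ l w := by
  have := (h w).resolve_left fun hwins => hv ⟨w, hw, hwins⟩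
  have := hk w
  omega

end Levels

section Run

variable {V : Type*} {G : SimpleGraph V} {lmax : V → ℕ} {l l' : V → ℤ}

/-- The probability with which the vertex `v` beeps at levels `l`, as a real number. -/
noncomputable def rate (lmax : V → ℕ) (l : V → ℤ) (v : V) : ℝ := beepProb (lmax v) (l v)

variable (lmax l) in
theorem rate_nonneg (v : V) : 0 ≤ rate lmax l v := NNReal.coe_nonneg _

variable (lmax l) in
theorem rate_le_one (v : V) : rate lmax l v ≤ 1 := beepProb_le_one (lmax v) (l v)

theorem rate_update_le {b : V → Bool} {u : V} (hm : 2 ≤ lmax u) (hu : 1 ≤ l u) (hul : l u ≤ lmax u)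
    (halone : ¬BeepsAlone G b u) :
    rate lmax (update G lmax l b) u ≤ rate lmax l u / 2 +
      (3 / 2 * rate lmax l u + 2 ^ (1 - (lmax u : ℤ))) *
        {b | ¬Hears G b u}.indicator 1 b := by
  by_cases h : Hears G b u
  · have : 2 * rate lmax (update G lmax l b) u ≤ rate lmax l u := by
      rw [rate, update_of_hears h]
      exact_mod_cast two_mul_beepProb_min_add_one_le (by omega)
    rw [Set.indicator_of_notMem (not_not.2 h)]
    linarith
  · have hbu : b u = false := Bool.eq_false_iff.2 fun hbu => halone ⟨hbu, h⟩
    have : rate lmax (update G lmax l b) u ≤ 2 * rate lmax l u + 2 ^ (1 - (lmax u : ℤ)) := by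
      rw [rate, update_of_silent h hbu]
      exact_mod_cast beepProb_max_sub_one_le hm hu hul
    rw [Set.indicator_of_mem (show b ∈ {b | ¬Hears G b u} from h), Pi.one_apply]
    linarith

variable [Fintype V]

theorem indepCoins_beeps (lmax : V → ℕ) (l : V → ℤ) :
    IndepCoins (beeps lmax l) (rate lmax l) := fun b => by
  classical
  rw [beeps, PMF.ofFintype_apply, ENNReal.coe_toReal, NNReal.coe_prod]
  refine prod_congr rfl fun v _ => ?_
  split_ifs
  · rfl
  · exact NNReal.coe_sub (beepProb_le_one _ _)

theorem admissible_of_mem_support {b : V → Bool} (hpos : ∀ v, 0 < lmax v)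
    (hb : b ∈ (beeps lmax l).support) : Admissible lmax l b :=
  ⟨fun v hv => (indepCoins_beeps lmax l).eq_true_of_mem_support hb <| by
      rw [rate, beepProb_of_nonpos hv (hpos v), NNReal.coe_one],
    fun v hv => (indepCoins_beeps lmax l).eq_false_of_mem_support hb <| by
      rw [rate, hv, beepProb_self, NNReal.coe_zero]⟩

theorem run_add (S T : ℕ) (l : V → ℤ) :
    run G lmax (S + T) l = (run G lmax S l).bind (run G lmax T) := by
  induction T with
  | zero => exact (PMF.bind_pure _).symm
  | succ T ih =>
    rw [← add_assoc, run, ih, PMF.bind_bind]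
    rfl

theorem prob_run_succ [DecidableEq V] (T : ℕ) (l : V → ℤ) (S : Set (V → ℤ)) :
    prob (run G lmax (T + 1) l) S =
      expect (beeps lmax l) fun b => prob (run G lmax T (update G lmax l b)) S := by
  rw [← prob_bind_eq_expect, add_comm T 1, run_add, run, run, PMF.pure_bind, step, PMF.bind_map]
  rfl

theorem of_mem_support_run {P : ℕ → (V → ℤ) → Prop}
    (hP : ∀ k l b, P k l → b ∈ (beeps lmax l).support → P (k + 1) (update G lmax l b))
    (h₀ : P 0 l) {T : ℕ} (hl' : l' ∈ (run G lmax T l).support) : P T l' := by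
  induction T generalizing l' with
  | zero => rwa [(PMF.mem_support_pure_iff _ _).1 hl']
  | succ T ih =>
    obtain ⟨l₁, hl₁, hl'⟩ := (PMF.mem_support_bind_iff _ _ _).1 hl'
    obtain ⟨b, hb, rfl⟩ := (PMF.mem_support_map_iff _ _ _).1 hl'
    exact hP T l₁ b (ih hl₁) hb

theorem prob_run_le_pow_mul [DecidableEq V] {P : (V → ℤ) → Prop} {Φ : (V → ℤ) → ℝ}
    {S : Set (V → ℤ)} {ρ : ℝ}
    (hρ : 0 ≤ ρ) (hP : ∀ l, P l → ∀ b ∈ (beeps lmax l).support, P (update G lmax l b))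
    (hS : ∀ l, P l → S.indicator 1 l ≤ Φ l)
    (hΦ : ∀ l, P l → expect (beeps lmax l) (fun b => Φ (update G lmax l b)) ≤ ρ * Φ l)
    (T : ℕ) (hl : P l) : prob (run G lmax T l) S ≤ ρ ^ T * Φ l := by
  induction T generalizing l with
  | zero =>
    have : prob (PMF.pure l) S = S.indicator 1 l := by
      by_cases hlS : l ∈ S <;> simp [prob, PMF.toOuterMeasure_pure_apply, hlS]
    rw [run, this, pow_zero, one_mul]
    exact hS l hl
  | succ T ih =>
    calc prob (run G lmax (T + 1) l) S
        = expect (beeps lmax l) fun b => prob (run G lmax T (update G lmax l b)) S :=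
          prob_run_succ T l S
      _ ≤ expect (beeps lmax l) (ρ ^ T • fun b => Φ (update G lmax l b)) :=
          expect_mono fun b hb => ih (hP l hl b hb)
      _ = ρ ^ T * expect (beeps lmax l) fun b => Φ (update G lmax l b) := map_smul _ _ _
      _ ≤ ρ ^ T * (ρ * Φ l) := mul_le_mul_of_nonneg_left (hΦ l hl) (pow_nonneg hρ T)
      _ = ρ ^ (T + 1) * Φ l := by ring

theorem isConfiguration_of_mem_support_run (hpos : ∀ v, 0 < lmax v) (hl : IsConfiguration lmax l)
    {T : ℕ} (hl' : l' ∈ (run G lmax T l).support) : IsConfiguration lmax l' :=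
  of_mem_support_run (P := fun _ => IsConfiguration lmax) (fun _ _ _ h _ => h.update hpos) hl hl'

theorem settled_of_mem_support_run (hpos : ∀ v, 0 < lmax v)
    (hcap : ∀ u v, G.Adj u v → lmax u = lmax v) (hl : IsConfiguration lmax l) {T : ℕ}
    (hl' : l' ∈ (run G lmax T l).support) : Settled G lmax T l' :=
  (of_mem_support_run (P := fun k l => IsConfiguration lmax l ∧ Settled G lmax k l)
    (fun _ _ _ h hb => ⟨h.1.update hpos,
      h.2.update h.1 hpos hcap (admissible_of_mem_support hpos hb)⟩)
    ⟨hl, hl.settled_zero⟩ hl').2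

theorem Wins.mem_misSet_of_mem_support_run {w : V} (hw : Wins G lmax w l)
    (hpos : ∀ v, 0 < lmax v) (hl : IsConfiguration lmax l) {T : ℕ} (hT : lmax w ≤ T)
    (hl' : l' ∈ (run G lmax T l).support) : w ∈ misSet G lmax l' := by
  obtain ⟨k, hk⟩ := hw
  refine (of_mem_support_run (P := fun j l => IsConfiguration lmax l ∧
    Dominates G lmax (k - j) w l ∧ (k < j → w ∈ misSet G lmax l)) (fun j l b h hb => ?_)
    ⟨hl, hk, by omega⟩ hl').2.2 ((hk.lt_lmax hl).trans_le hT)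
  have hb := admissible_of_mem_support hpos hb
  refine ⟨h.1.update hpos, h.2.1.update h.1 hb, fun hkj => Dominates.update_mem_misSet ?_ h.1 hb⟩
  rw [← Nat.sub_eq_zero_of_le (Nat.le_of_lt_succ hkj)]
  exact h.2.1

end Run

section Drift

variable {V : Type*} [Fintype V]

/-- The probability with which no neighbor of `v` beeps at levels `l`. -/
noncomputable def quietProb (G : SimpleGraph V) (lmax : V → ℕ) (l : V → ℤ) (v : V) : ℝ :=
  prob (beeps lmax l) {b | ¬Hears G b v}

theorem quietProb_le_one (G : SimpleGraph V) (lmax : V → ℕ) (l : V → ℤ) (v : V) :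
    quietProb G lmax l v ≤ 1 := prob_le_one _ _

variable {G : SimpleGraph V} [DecidableRel G.Adj] {lmax : V → ℕ} {l : V → ℤ} {b : V → Bool} {v : V}

theorem not_hears_iff : ¬Hears G b v ↔ ∀ u ∈ G.neighborFinset v, b u = false := by
  simp [Hears]

/-- The expected number of neighbors of `v` that beep at levels `l`. -/
noncomputable def load (G : SimpleGraph V) [DecidableRel G.Adj] (lmax : V → ℕ) (l : V → ℤ)
    (v : V) : ℝ := ∑ u ∈ G.neighborFinset v, rate lmax l u

variable (G lmax l v)

theorem load_nonneg : 0 ≤ load G lmax l v := sum_nonneg fun _ _ => rate_nonneg _ _ _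

theorem load_le_degree : load G lmax l v ≤ G.degree v := by
  simpa [load] using sum_le_sum fun u (_ : u ∈ G.neighborFinset v) => rate_le_one lmax l u

theorem prob_hears_le_load : prob (beeps lmax l) {b | Hears G b v} ≤ load G lmax l v :=
  calc prob (beeps lmax l) {b | Hears G b v}
      ≤ prob (beeps lmax l) (⋃ u ∈ G.neighborFinset v, {b | b u = true}) :=
        prob_mono fun b _ ⟨u, hu, hbu⟩ => Set.mem_biUnion (by simpa using hu) hbu
    _ ≤ ∑ u ∈ G.neighborFinset v, prob (beeps lmax l) {b | b u = true} := prob_biUnion_le _ _ _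
    _ = load G lmax l v := sum_congr rfl fun u _ => (indepCoins_beeps lmax l).prob_true u

theorem one_sub_load_le_quietProb : 1 - load G lmax l v ≤ quietProb G lmax l v := by
  rw [quietProb, ← Set.compl_ofPred, prob_compl]
  exact sub_le_sub_left (prob_hears_le_load G lmax l v) 1

/-- The part of the load that survives although all neighbors of `v` are close to their caps:
a neighbor `u` at its cap returns to the beeping probability `2 ^ (1 - lmax u)`. -/
noncomputable def capLoad (G : SimpleGraph V) [DecidableRel G.Adj] (lmax : V → ℕ) (v : V) : ℝ :=
  ∑ u ∈ G.neighborFinset v, 2 ^ (1 - (lmax u : ℤ))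

/-- An upper bound for the load of `v` after a round with beeps `b` in which no neighbor of `v`
beeps alone: rates of neighbors that hear a beep are halved, the others at most double, up to the
contribution of the caps. -/
noncomputable def loadBound (G : SimpleGraph V) [DecidableRel G.Adj] (lmax : V → ℕ) (l : V → ℤ)
    (v : V) (b : V → Bool) : ℝ :=
  ∑ u ∈ G.neighborFinset v, (rate lmax l u / 2 +
    (3 / 2 * rate lmax l u + 2 ^ (1 - (lmax u : ℤ))) * {b | ¬Hears G b u}.indicator 1 b)

theorem loadBound_nonneg (b : V → Bool) : 0 ≤ loadBound G lmax l v b :=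
  sum_nonneg fun u _ => by
    have := rate_nonneg lmax l u
    have : (0 : ℝ) ≤ {b | ¬Hears G b u}.indicator 1 b :=
      Set.indicator_nonneg (fun _ _ => zero_le_one) b
    positivity

theorem loadBound_le (b : V → Bool) :
    loadBound G lmax l v b ≤ 2 * load G lmax l v + capLoad G lmax v := by
  rw [load, capLoad, mul_sum, ← sum_add_distrib]
  refine sum_le_sum fun u _ => ?_
  have hrate := rate_nonneg lmax l u
  have hind : {b | ¬Hears G b u}.indicator 1 b ≤ (1 : ℝ) :=
    Set.indicator_le_self' (fun _ _ => zero_le_one) b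
  calc rate lmax l u / 2 + (3 / 2 * rate lmax l u + 2 ^ (1 - (lmax u : ℤ))) *
        {b | ¬Hears G b u}.indicator 1 b
      ≤ rate lmax l u / 2 + (3 / 2 * rate lmax l u + 2 ^ (1 - (lmax u : ℤ))) * 1 := by gcongr
    _ = 2 * rate lmax l u + 2 ^ (1 - (lmax u : ℤ)) := by ring

variable {G lmax l v}

theorem capLoad_le (hcap : ∀ u v, G.Adj u v → lmax u = lmax v)
    (h : Real.logb 2 (max (G.degree v : ℝ) 1) + 5 ≤ lmax v) : capLoad G lmax v ≤ 1 / 16 := by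
  have hpow : max (G.degree v : ℝ) 1 * 2 ^ 5 ≤ 2 ^ lmax v := by
    have := Real.rpow_le_rpow_of_exponent_le one_le_two h
    rwa [Real.rpow_add two_pos, Real.rpow_logb two_pos (by norm_num) (by positivity),
      Real.rpow_natCast, Real.rpow_ofNat] at this
  calc capLoad G lmax v = ∑ _u ∈ G.neighborFinset v, (2 : ℝ) ^ (1 - (lmax v : ℤ)) :=
        sum_congr rfl fun u hu => by rw [hcap v u (by simpa using hu)]
    _ = G.degree v * (2 / 2 ^ lmax v) := by
        rw [sum_const, nsmul_eq_mul, G.card_neighborFinset_eq_degree, zpow_sub₀ two_ne_zero,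
          zpow_one, zpow_natCast]
    _ ≤ 1 / 16 := by
        rw [← mul_div_assoc, div_le_iff₀ (by positivity)]
        linarith [le_max_left (G.degree v : ℝ) 1]

theorem load_update_le_loadBound (hm : ∀ v, 2 ≤ lmax v) (hl : IsConfiguration lmax l)
    (hone : ∀ w, w = v ∨ G.Adj v w → 1 ≤ l w) (hb : b ∈ noneAlone G v) :
    load G lmax (update G lmax l b) v ≤ loadBound G lmax l v b :=
  sum_le_sum fun u hu => by
    have hu : u = v ∨ G.Adj v u := Or.inr (by simpa using hu)
    exact rate_update_le (hm u) (hone u hu) (hl u).2 (hb u hu)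

/-- The neighbors of `v` whose own neighborhoods are silent with probability at least `1/15`. For
the other neighbors the expected rate shrinks by the factor `1/2 + 3/2 * 1/15 = 3/5`, up to the
contribution of the caps. -/
noncomputable def lightNbrs (G : SimpleGraph V) [DecidableRel G.Adj] (lmax : V → ℕ) (l : V → ℤ)
    (v : V) : Finset V := {u ∈ G.neighborFinset v | 1 / 15 ≤ quietProb G lmax l u}

theorem expect_loadBound_le [DecidableEq V] (hcapLoad : capLoad G lmax v ≤ 1 / 16)
    (hlight : ∑ u ∈ lightNbrs G lmax l v, rate lmax l u ≤ 1 / 100) :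
    expect (beeps lmax l) (loadBound G lmax l v) ≤ 3 / 5 * load G lmax l v + 31 / 400 := by
  have hnbr : ∀ u, rate lmax l u / 2 +
      (3 / 2 * rate lmax l u + 2 ^ (1 - (lmax u : ℤ))) * quietProb G lmax l u ≤
      3 / 5 * rate lmax l u + 2 ^ (1 - (lmax u : ℤ)) +
        3 / 2 * if 1 / 15 ≤ quietProb G lmax l u then rate lmax l u else 0 := fun u => by
    have hrate := rate_nonneg lmax l u
    have hquiet := mul_le_mul_of_nonneg_left (quietProb_le_one G lmax l u)
      (by positivity : (0 : ℝ) ≤ 2 ^ (1 - (lmax u : ℤ)))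
    split_ifs with h
    · have := mul_le_mul_of_nonneg_left (quietProb_le_one G lmax l u) hrate
      linarith
    · have := mul_le_mul_of_nonneg_left (not_le.1 h).le hrate
      linarith
  calc expect (beeps lmax l) (loadBound G lmax l v)
      = ∑ u ∈ G.neighborFinset v, (rate lmax l u / 2 +
          (3 / 2 * rate lmax l u + 2 ^ (1 - (lmax u : ℤ))) * quietProb G lmax l u) :=
        expect_sum_add_mul_indicator _ _ _ _ _
    _ ≤ _ := sum_le_sum fun u _ => hnbr u
    _ = 3 / 5 * load G lmax l v + capLoad G lmax v +
          3 / 2 * ∑ u ∈ lightNbrs G lmax l v, rate lmax l u := by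
        rw [sum_add_distrib, sum_add_distrib, ← mul_sum, ← mul_sum, ← sum_filter]
        rfl
    _ ≤ 3 / 5 * load G lmax l v + 31 / 400 := by linarith

/-- A lower bound for the probability that some vertex of the closed neighborhood of `v` beeps
alone, in the cases where the potential is not contracted. The factor `1/101` is
`1 - (1 + 1/100)⁻¹`, with `1/100` the least load of light neighbors for which the bound is used. -/
noncomputable def aloneProb : ℝ := 1 / 15 * (1 / 101)

theorem prob_noneAlone_le_of_lightLoad
    (hlight : 1 / 100 ≤ ∑ u ∈ lightNbrs G lmax l v, rate lmax l u) :
    prob (beeps lmax l) (noneAlone G v) ≤ 1 - aloneProb := by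
  have hcoins := indepCoins_beeps lmax l
  have hsilent : prob (beeps lmax l) {b | ∀ u ∈ lightNbrs G lmax l v, b u = false} ≤ 100 / 101 :=
    calc _ ≤ (1 + ∑ u ∈ lightNbrs G lmax l v, rate lmax l u)⁻¹ :=
          hcoins.prob_forall_false_le_inv _
      _ ≤ (1 + 1 / 100)⁻¹ := by gcongr
      _ = 100 / 101 := by norm_num
  have halone := hcoins.le_prob_exists_alone (N := fun u => G.neighborFinset u) (η := 1 / 15)
    (fun u => by simp) (lightNbrs G lmax l v) fun u hu => by
      simpa only [quietProb, not_hears_iff] using (mem_filter.1 hu).2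
  refine prob_le_one_sub_of_le_prob (le_trans ?_ halone) fun b _ ⟨u, hu, hbu, hsil⟩ hb =>
    hb u (Or.inr (by simpa using (mem_filter.1 hu).1)) ⟨hbu, not_hears_iff.2 hsil⟩
  rw [aloneProb]
  linarith

theorem prob_noneAlone_le_of_level_eq_one (hm : 2 ≤ lmax v) (hv : l v = 1)
    (hload : load G lmax l v ≤ 3 / 5) :
    prob (beeps lmax l) (noneAlone G v) ≤ 1 - aloneProb := by
  have hrate : rate lmax l v = 1 / 2 := by
    rw [rate, hv, beepProb_of_nonneg zero_le_one (by omega)]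
    norm_num
  have halone : prob (beeps lmax l) {b | BeepsAlone G b v} = 1 / 2 * quietProb G lmax l v := by
    simp only [BeepsAlone, quietProb, not_hears_iff]
    rw [(indepCoins_beeps lmax l).prob_true_and_forall_false (by simp),
      (indepCoins_beeps lmax l).prob_forall_false, hrate]
  refine prob_le_one_sub_of_le_prob (T := {b | BeepsAlone G b v}) ?_
    fun b _ hbv hb => hb v (Or.inl rfl) hbv
  have := one_sub_load_le_quietProb G lmax l v
  rw [halone, aloneProb]
  linarith

/-- The potential of `v`: it falls with the load of `v` as well as with the level of `v`. -/
noncomputable def potential (G : SimpleGraph V) [DecidableRel G.Adj] (lmax : V → ℕ) (v : V)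
    (l : V → ℤ) : ℝ := (1 + load G lmax l v) * (11 / 10) ^ l v

theorem potential_pos : 0 < potential G lmax v l := by
  have := load_nonneg G lmax l v
  rw [potential]
  positivity

theorem potential_update_le (hm : ∀ v, 2 ≤ lmax v) (hl : IsConfiguration lmax l)
    (hone : ∀ w, w = v ∨ G.Adj v w → 1 ≤ l w) (hb : b ∈ noneAlone G v) {x : ℤ}
    (hx : update G lmax l b v ≤ l v + x) :
    potential G lmax v (update G lmax l b) ≤
      (11 / 10) ^ x * (1 + loadBound G lmax l v b) * (11 / 10) ^ l v := by
  have := loadBound_nonneg G lmax l v b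
  calc potential G lmax v (update G lmax l b)
      ≤ (1 + loadBound G lmax l v b) * (11 / 10) ^ (l v + x) := by
        refine mul_le_mul ?_ (zpow_le_zpow_right₀ (by norm_num) hx) (by positivity) (by positivity)
        exact add_le_add_right (load_update_le_loadBound hm hl hone hb) 1
    _ = (11 / 10) ^ x * (1 + loadBound G lmax l v b) * (11 / 10) ^ l v := by
        rw [zpow_add₀ (by norm_num)]
        ring

theorem potential_update_le_three_mul (hm : ∀ v, 2 ≤ lmax v) (hl : IsConfiguration lmax l)
    (hcapLoad : capLoad G lmax v ≤ 1 / 16) (hone : ∀ w, w = v ∨ G.Adj v w → 1 ≤ l w)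
    (hb : b ∈ noneAlone G v) :
    potential G lmax v (update G lmax l b) ≤ 3 * potential G lmax v l := by
  refine (potential_update_le hm hl hone hb (update_le_add_one (hone v (Or.inl rfl)))).trans ?_
  rw [potential, ← mul_assoc, zpow_one]
  refine mul_le_mul_of_nonneg_right ?_ (by positivity)
  have := load_nonneg G lmax l v
  have := loadBound_le G lmax l v b
  linarith

theorem expect_potential_update_le_of_load_ge [DecidableEq V] (hm : ∀ v, 2 ≤ lmax v)
    (hl : IsConfiguration lmax l) (hcapLoad : capLoad G lmax v ≤ 1 / 16)
    (hone : ∀ w, w = v ∨ G.Adj v w → 1 ≤ l w)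
    (hlight : ∑ u ∈ lightNbrs G lmax l v, rate lmax l u ≤ 1 / 100)
    (hload : 3 / 5 ≤ load G lmax l v) :
    expect (beeps lmax l)
        ((noneAlone G v).indicator fun b => potential G lmax v (update G lmax l b)) ≤
      (1 - 1 / 100) * potential G lmax v l := by
  set z : ℝ := (11 / 10) ^ l v
  have hz₀ : 0 < z := by positivity
  calc _ ≤ expect (beeps lmax l) fun b =>
          11 / 10 * z * loadBound G lmax l v b + 11 / 10 * z + 0 * Set.univ.indicator 1 b :=
        expect_indicator_le (fun b => by
            have := loadBound_nonneg G lmax l v b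
            simp only [zero_mul, add_zero]
            positivity)
          fun b _ hb => (potential_update_le hm hl hone hb
            (update_le_add_one (hone v (Or.inl rfl)))).trans_eq (by rw [zpow_one]; ring)
    _ = 11 / 10 * (1 + expect (beeps lmax l) (loadBound G lmax l v)) * z := by
        rw [expect_affine]
        ring
    _ ≤ (1 - 1 / 100) * (1 + load G lmax l v) * z := by
        have := expect_loadBound_le hcapLoad hlight
        exact mul_le_mul_of_nonneg_right (by linarith) hz₀.le
    _ = (1 - 1 / 100) * potential G lmax v l := mul_assoc _ _ _

theorem potential_update_le_of_two_le (hm : ∀ v, 2 ≤ lmax v) (hl : IsConfiguration lmax l)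
    (hcapLoad : capLoad G lmax v ≤ 1 / 16) (hone : ∀ w, w = v ∨ G.Adj v w → 1 ≤ l w)
    (hv : 2 ≤ l v) (hb : b ∈ noneAlone G v) :
    potential G lmax v (update G lmax l b) ≤
      (10 / 11 * (1 + loadBound G lmax l v b) +
        21 / 110 * (17 / 16 + 2 * load G lmax l v) * {b | Hears G b v}.indicator 1 b) *
        (11 / 10) ^ l v := by
  have hload := loadBound_le G lmax l v b
  by_cases hhears : Hears G b v
  · refine (potential_update_le hm hl hone hb (update_le_add_one (hone v (Or.inl rfl)))).trans ?_
    gcongr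
    rw [Set.indicator_of_mem (show b ∈ {b | Hears G b v} from hhears), Pi.one_apply]
    linarith
  · have hbv : b v = false := Bool.eq_false_iff.2 fun hbv => hb v (Or.inl rfl) ⟨hbv, hhears⟩
    refine (potential_update_le hm hl hone hb (x := -1) ?_).trans_eq ?_
    · rw [update_of_silent hhears hbv]
      omega
    · simp [hhears]

theorem expect_potential_update_le_of_load_le [DecidableEq V] (hm : ∀ v, 2 ≤ lmax v)
    (hl : IsConfiguration lmax l) (hcapLoad : capLoad G lmax v ≤ 1 / 16)
    (hone : ∀ w, w = v ∨ G.Adj v w → 1 ≤ l w)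
    (hlight : ∑ u ∈ lightNbrs G lmax l v, rate lmax l u ≤ 1 / 100)
    (hload : load G lmax l v ≤ 3 / 5) (hv : 2 ≤ l v) :
    expect (beeps lmax l)
        ((noneAlone G v).indicator fun b => potential G lmax v (update G lmax l b)) ≤
      (1 - 1 / 100) * potential G lmax v l := by
  set z : ℝ := (11 / 10) ^ l v
  set d := load G lmax l v
  have hz₀ : 0 < z := by positivity
  have hd : 0 ≤ d := load_nonneg G lmax l v
  calc _ ≤ expect (beeps lmax l) fun b => 10 / 11 * z * loadBound G lmax l v b + 10 / 11 * z +
          21 / 110 * (17 / 16 + 2 * d) * z * {b | Hears G b v}.indicator 1 b :=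
        expect_indicator_le (fun b => by
            have := loadBound_nonneg G lmax l v b
            have : (0 : ℝ) ≤ {b | Hears G b v}.indicator 1 b :=
              Set.indicator_nonneg (fun _ _ => zero_le_one) b
            positivity)
          fun b _ hb => (potential_update_le_of_two_le hm hl hcapLoad hone hv hb).trans_eq (by
            ring)
    _ = (10 / 11 * (1 + expect (beeps lmax l) (loadBound G lmax l v)) +
          21 / 110 * (17 / 16 + 2 * d) * prob (beeps lmax l) {b | Hears G b v}) * z := by
        rw [expect_affine]
        ring
    _ ≤ (10 / 11 * (1 + (3 / 5 * d + 31 / 400)) + 21 / 110 * (17 / 16 + 2 * d) * d) * z := by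
        gcongr
        · exact expect_loadBound_le hcapLoad hlight
        · exact prob_hears_le_load G lmax l v
    _ ≤ (1 - 1 / 100) * (1 + d) * z := by
        refine mul_le_mul_of_nonneg_right ?_ hz₀.le
        linarith [mul_nonneg hd (sub_nonneg.2 hload)]
    _ = (1 - 1 / 100) * potential G lmax v l := mul_assoc _ _ _

/-- The potential to a small power while `v` is not covered, and `0` from then on. The power makes
it contract also in those rounds in which covering `v` is merely possible. -/
noncomputable def coverPotential (G : SimpleGraph V) [DecidableRel G.Adj] (lmax : V → ℕ) (v : V) :
    (V → ℤ) → ℝ :=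
  {l | ¬Covered G lmax l v}.indicator fun l => potential G lmax v l ^ (aloneProb / 4)

theorem coverPotential_of_covered (h : Covered G lmax l v) : coverPotential G lmax v l = 0 :=
  Set.indicator_of_notMem (not_not.2 h) _

theorem coverPotential_of_not_covered (h : ¬Covered G lmax l v) :
    coverPotential G lmax v l = potential G lmax v l ^ (aloneProb / 4) :=
  Set.indicator_of_mem (s := {l | ¬Covered G lmax l v}) h _

theorem expect_noneAlone_potential_rpow_le [DecidableEq V] (hm : ∀ v, 2 ≤ lmax v)
    (hl : IsConfiguration lmax l) (hcapLoad : capLoad G lmax v ≤ 1 / 16)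
    (hone : ∀ w, w = v ∨ G.Adj v w → 1 ≤ l w) :
    expect (beeps lmax l) ((noneAlone G v).indicator fun b =>
        potential G lmax v (update G lmax l b) ^ (aloneProb / 4)) ≤
      (1 - aloneProb / 400) * potential G lmax v l ^ (aloneProb / 4) := by
  have hs₀ : 0 ≤ aloneProb / 4 := by norm_num [aloneProb]
  have hs₁ : aloneProb / 4 ≤ 1 := by norm_num [aloneProb]
  have hpot : ∀ b, 0 ≤ potential G lmax v (update G lmax l b) := fun b => potential_pos.le
  have of_prob (h : prob (beeps lmax l) (noneAlone G v) ≤ 1 - aloneProb) :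
      expect (beeps lmax l) ((noneAlone G v).indicator fun b =>
        potential G lmax v (update G lmax l b) ^ (aloneProb / 4)) ≤
      (1 - aloneProb / 400) * potential G lmax v l ^ (aloneProb / 4) :=
    (expect_indicator_rpow_le_of_prob_le hpot potential_pos hs₀ hs₁ (by norm_num : (1 : ℝ) ≤ 3)
      (fun b _ hb => potential_update_le_three_mul hm hl hcapLoad hone hb) h).trans <|
      mul_le_mul_of_nonneg_right (by norm_num [aloneProb]) (Real.rpow_nonneg potential_pos.le _)
  have of_expect (h : expect (beeps lmax l)
      ((noneAlone G v).indicator fun b => potential G lmax v (update G lmax l b)) ≤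
        (1 - 1 / 100) * potential G lmax v l) :
      expect (beeps lmax l) ((noneAlone G v).indicator fun b =>
        potential G lmax v (update G lmax l b) ^ (aloneProb / 4)) ≤
      (1 - aloneProb / 400) * potential G lmax v l ^ (aloneProb / 4) :=
    (expect_indicator_rpow_le_of_expect_le hpot potential_pos hs₀ hs₁ h).trans_eq (by
      norm_num [aloneProb])
  rcases le_total (1 / 100) (∑ u ∈ lightNbrs G lmax l v, rate lmax l u) with hlight | hlight
  · exact of_prob (prob_noneAlone_le_of_lightLoad hlight)
  rcases le_total (3 / 5) (load G lmax l v) with hload | hload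
  · exact of_expect (expect_potential_update_le_of_load_ge hm hl hcapLoad hone hlight hload)
  rcases (hone v (Or.inl rfl)).eq_or_lt with hv | hv
  · exact of_prob (prob_noneAlone_le_of_level_eq_one (hm v) hv.symm hload)
  · exact of_expect (expect_potential_update_le_of_load_le hm hl hcapLoad hone hlight hload hv)

theorem expect_coverPotential_update_le [DecidableEq V] (hm : ∀ v, 2 ≤ lmax v)
    (hcap : ∀ u v, G.Adj u v → lmax u = lmax v) (hl : IsConfiguration lmax l)
    (hcapLoad : capLoad G lmax v ≤ 1 / 16)
    (hone : ¬Covered G lmax l v → ∀ w, w = v ∨ G.Adj v w → 1 ≤ l w) :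
    expect (beeps lmax l) (fun b => coverPotential G lmax v (update G lmax l b)) ≤
      (1 - aloneProb / 400) * coverPotential G lmax v l := by
  have hpos : ∀ v, 0 < lmax v := fun v => two_pos.trans_le (hm v)
  by_cases hv : Covered G lmax l v
  · calc _ ≤ expect (beeps lmax l) (fun _ => 0) := expect_mono fun b hb =>
          (coverPotential_of_covered (hv.update hl (admissible_of_mem_support hpos hb))).le
      _ = (1 - aloneProb / 400) * coverPotential G lmax v l := by
          rw [expect_const, coverPotential_of_covered hv, mul_zero]
  · calc _ ≤ expect (beeps lmax l) ((noneAlone G v).indicator fun b =>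
            potential G lmax v (update G lmax l b) ^ (aloneProb / 4)) :=
          expect_mono fun b hb => Set.indicator_apply_le' (fun h => by
              rw [Set.indicator_of_mem (mem_noneAlone_of_not_covered_update h hpos hcap
                (admissible_of_mem_support hpos hb))])
            fun _ => Set.indicator_nonneg (fun _ _ => Real.rpow_nonneg potential_pos.le _) b
      _ ≤ (1 - aloneProb / 400) * potential G lmax v l ^ (aloneProb / 4) :=
          expect_noneAlone_potential_rpow_le hm hl hcapLoad (hone hv)
      _ = (1 - aloneProb / 400) * coverPotential G lmax v l := by
          rw [coverPotential_of_not_covered hv]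

end Drift

section Stability

variable {V : Type*} {G : SimpleGraph V} {lmax : V → ℕ} {l l' : V → ℤ}

theorem update_eq_self_of_stableSet_eq_univ {b : V → Bool} (h : stableSet G lmax l = Set.univ)
    (hb : Admissible lmax l b) : update G lmax l b = l := by
  have beeps_of_mem {w : V} (hw : w ∈ misSet G lmax l) : b w = true := hb.1 w (by
    have := hw.1
    omega)
  ext v
  rcases Set.eq_univ_iff_forall.1 h v with hv | ⟨u, hu, huv⟩
  · have hsilent : ¬Hears G b v := fun ⟨u, hu, hbu⟩ => by simp [hb.2 u (hv.2 u hu)] at hbu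
    rw [BeepsAlone.update_eq ⟨beeps_of_mem hv, hsilent⟩, hv.1]
  · rw [update_of_hears ⟨u, huv.symm, beeps_of_mem hu⟩, hu.2 v huv]
    exact min_eq_right (Int.le.intro 1 rfl)

theorem maximal_isIndepSet_misSet (hpos : ∀ v, 0 < lmax v) (h : stableSet G lmax l = Set.univ) :
    Maximal G.IsIndepSet (misSet G lmax l) := by
  refine ⟨fun u hu w hw _ huw => ?_, fun S hS hsub v hv => ?_⟩
  · have := hpos w
    have := hw.1
    have := hu.2 w huw
    omega
  · exact (Set.eq_univ_iff_forall.1 h v).resolve_right fun ⟨u, hu, huv⟩ =>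
      hS (hsub hu) hv huv.ne huv

variable [Fintype V]

theorem isStableMIS_of_stableSet_eq_univ (hpos : ∀ v, 0 < lmax v)
    (h : stableSet G lmax l = Set.univ) : IsStableMIS G lmax l := by
  have hstep : step G lmax l = PMF.pure l := eq_pure_of_support_subset fun l' hl' => by
    obtain ⟨b, hb, rfl⟩ := (PMF.mem_support_map_iff _ _ _).1 hl'
    exact update_eq_self_of_stableSet_eq_univ h (admissible_of_mem_support hpos hb)
  refine ⟨maximal_isIndepSet_misSet hpos h, h, fun k => ?_⟩
  induction k with
  | zero => rfl
  | succ k ih => rw [run, ih, PMF.pure_bind, hstep]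

theorem isStableMIS_of_mem_support_run (hpos : ∀ v, 0 < lmax v) (hl : IsConfiguration lmax l)
    (hcov : ∀ v, Covered G lmax l v) {T : ℕ} (hT : ∀ v, lmax v ≤ T)
    (hl' : l' ∈ (run G lmax T l).support) : IsStableMIS G lmax l' := by
  refine isStableMIS_of_stableSet_eq_univ hpos (Set.eq_univ_iff_forall.2 fun v => ?_)
  obtain ⟨w, hw, hwins⟩ := hcov v
  have hwmem := hwins.mem_misSet_of_mem_support_run hpos hl (hT w) hl'
  rcases hw with rfl | hvw
  · exact Or.inl hwmem
  · exact Or.inr ⟨w, hwmem, hvw.symm⟩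

variable [DecidableRel G.Adj]

theorem indicator_not_covered_le_coverPotential {v : V}
    (hv : ¬Covered G lmax l v → 1 ≤ l v) :
    {l | ¬Covered G lmax l v}.indicator 1 l ≤ coverPotential G lmax v l := by
  refine Set.indicator_le_indicator' fun h => Real.one_le_rpow ?_ (by norm_num [aloneProb])
  have := load_nonneg G lmax l v
  exact one_le_mul_of_one_le_of_one_le (by linarith)
    (one_le_zpow₀ (by norm_num) (zero_le_one.trans (hv h)))

theorem coverPotential_le {M : ℕ} {v : V} (hl : l v ≤ M) :
    coverPotential G lmax v l ≤ Fintype.card V * 2 ^ M := by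
  have hload : 1 + load G lmax l v ≤ Fintype.card V := by
    have : ((G.degree v + 1 : ℕ) : ℝ) ≤ Fintype.card V := by
      exact_mod_cast G.degree_lt_card_verts v
    push_cast at this
    linarith [load_le_degree G lmax l v]
  have hcard : (1 : ℝ) ≤ Fintype.card V := by linarith [load_nonneg G lmax l v]
  have hpot : potential G lmax v l ≤ Fintype.card V * 2 ^ M := by
    refine mul_le_mul hload ?_ (by positivity) (by positivity)
    calc (11 / 10 : ℝ) ^ l v ≤ (11 / 10) ^ (M : ℤ) := zpow_le_zpow_right₀ (by norm_num) hl
      _ = (11 / 10) ^ M := zpow_natCast _ _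
      _ ≤ 2 ^ M := by gcongr; norm_num
  have hone : (1 : ℝ) ≤ Fintype.card V * 2 ^ M :=
    one_le_mul_of_one_le_of_one_le hcard (one_le_pow₀ one_le_two)
  refine Set.indicator_apply_le' (fun _ => ?_) fun _ => by positivity
  calc potential G lmax v l ^ (aloneProb / 4)
      ≤ (Fintype.card V * 2 ^ M : ℝ) ^ (aloneProb / 4) :=
        Real.rpow_le_rpow potential_pos.le hpot (by norm_num [aloneProb])
    _ ≤ Fintype.card V * 2 ^ M := Real.rpow_le_self_of_one_le hone (by norm_num [aloneProb])

theorem prob_not_covered_le {M : ℕ} (hm : ∀ v, 2 ≤ lmax v) (hM : ∀ v, lmax v ≤ M)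
    (hcap : ∀ u v, G.Adj u v → lmax u = lmax v) {v : V} (hcapLoad : capLoad G lmax v ≤ 1 / 16)
    (hl : IsConfiguration lmax l) (hset : Settled G lmax (M + 1) l) (T : ℕ) :
    prob (run G lmax T l) {l | ¬Covered G lmax l v} ≤
      (1 - aloneProb / 400) ^ T * (Fintype.card V * 2 ^ M) := by
  classical
  have hpos : ∀ v, 0 < lmax v := fun v => two_pos.trans_le (hm v)
  have hρ : 0 ≤ 1 - aloneProb / 400 := by norm_num [aloneProb]
  have hone : ∀ l, Settled G lmax (M + 1) l → ¬Covered G lmax l v →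
      ∀ w, w = v ∨ G.Adj v w → 1 ≤ l w := fun l h hv w hw =>
    h.one_le (fun v => Nat.succ_le_succ (hM v)) hv hw
  calc prob (run G lmax T l) {l | ¬Covered G lmax l v}
      ≤ (1 - aloneProb / 400) ^ T * coverPotential G lmax v l :=
        prob_run_le_pow_mul (P := fun l => IsConfiguration lmax l ∧ Settled G lmax (M + 1) l) hρ
          (fun l h b hb => ⟨h.1.update hpos, (h.2.update h.1 hpos hcap
            (admissible_of_mem_support hpos hb)).anti (Nat.le_succ _)⟩)
          (fun l h => indicator_not_covered_le_coverPotential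
            fun hv => hone l h.2 hv v (Or.inl rfl))
          (fun l h => expect_coverPotential_update_le hm hcap h.1 hcapLoad (hone l h.2))
          T ⟨hl, hset⟩
    _ ≤ (1 - aloneProb / 400) ^ T * (Fintype.card V * 2 ^ M) := by
        gcongr
        exact coverPotential_le ((hl v).2.trans (by exact_mod_cast hM v))

theorem prob_not_isStableMIS_le {M : ℕ} (hm : ∀ v, 2 ≤ lmax v) (hM : ∀ v, lmax v ≤ M)
    (hcap : ∀ u v, G.Adj u v → lmax u = lmax v) (hcapLoad : ∀ v, capLoad G lmax v ≤ 1 / 16)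
    (hl : IsConfiguration lmax l) (T : ℕ) :
    prob (run G lmax (M + 1 + (T + M)) l) {l | ¬IsStableMIS G lmax l} ≤
      Fintype.card V * ((1 - aloneProb / 400) ^ T * (Fintype.card V * 2 ^ M)) := by
  have hpos : ∀ v, 0 < lmax v := fun v => two_pos.trans_le (hm v)
  rw [run_add]
  refine prob_bind_le fun l₁ hl₁ => ?_
  have hconf₁ := isConfiguration_of_mem_support_run hpos hl hl₁
  have hset := settled_of_mem_support_run hpos hcap hl hl₁
  calc prob (run G lmax (T + M) l₁) {l | ¬IsStableMIS G lmax l}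
      ≤ prob (run G lmax T l₁) (⋃ v ∈ (univ : Finset V), {l | ¬Covered G lmax l v}) := by
        rw [run_add]
        refine prob_bind_le_prob fun l₂ hl₂ hcov => Set.disjoint_left.2 fun l₃ hl₃ hunstable =>
          hunstable (isStableMIS_of_mem_support_run hpos
            (isConfiguration_of_mem_support_run hpos hconf₁ hl₂) (fun v => ?_) hM hl₃)
        by_contra hv
        exact hcov (Set.mem_biUnion (mem_univ v) hv)
    _ ≤ ∑ v, prob (run G lmax T l₁) {l | ¬Covered G lmax l v} := prob_biUnion_le _ _ _
    _ ≤ ∑ _v : V, (1 - aloneProb / 400) ^ T * (Fintype.card V * 2 ^ M) :=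
        sum_le_sum fun v _ => prob_not_covered_le hm hM hcap (hcapLoad v) hconf₁ hset T
    _ = Fintype.card V * ((1 - aloneProb / 400) ^ T * (Fintype.card V * 2 ^ M)) := by
        rw [sum_const, nsmul_eq_mul, card_univ]

end Stability

section Numerics

theorem exists_floor_eq_add {c q Λ : ℝ} (hc : 2 ≤ c * Λ) (hq : 0 ≤ q * Λ) :
    ∃ T : ℕ, ⌊(3 * c + q) * Λ⌋₊ = ⌊c * Λ⌋₊ + 1 + (T + ⌊c * Λ⌋₊) ∧ q * Λ ≤ T := by
  set R := ⌊(3 * c + q) * Λ⌋₊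
  set M := ⌊c * Λ⌋₊
  have hR : (3 * c + q) * Λ < R + 1 := Nat.lt_floor_add_one _
  have hM : M ≤ c * Λ := Nat.floor_le (zero_le_two.trans hc)
  have hMR : M + 1 + M < R + 1 := by
    rify
    linarith
  obtain ⟨T, hT⟩ := Nat.exists_eq_add_of_le (Nat.le_of_lt_succ hMR)
  have hRT : (R : ℝ) = M + 1 + M + T := by exact_mod_cast hT
  exact ⟨T, by omega, by linarith⟩

variable {n c : ℝ}

theorem two_pow_le_rpow {M : ℕ} (hn : 0 < n) (hM : M ≤ c * Real.logb 2 n) :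
    (2 : ℝ) ^ M ≤ n ^ c :=
  calc (2 : ℝ) ^ M = 2 ^ (M : ℝ) := (Real.rpow_natCast _ _).symm
    _ ≤ 2 ^ (Real.logb 2 n * c) :=
        Real.rpow_le_rpow_of_exponent_le one_le_two (hM.trans_eq (mul_comm _ _))
    _ = n ^ c := by rw [Real.rpow_mul zero_le_two, Real.rpow_logb two_pos (by norm_num) hn]

theorem one_sub_pow_le_rpow_neg {r x : ℝ} {T : ℕ} (hn : 1 ≤ n) (hr : 0 ≤ r) (hx : x ≤ 1)
    (hT : r * Real.logb 2 n ≤ x * T) : (1 - x) ^ T ≤ n ^ (-r) := by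
  have hlog : Real.log n ≤ Real.logb 2 n := by
    rw [Real.logb]
    exact le_div_self (Real.log_nonneg hn) (Real.log_pos one_lt_two)
      (Real.log_two_lt_d9.le.trans (by norm_num))
  calc (1 - x) ^ T ≤ Real.exp (-x) ^ T :=
        pow_le_pow_left₀ (sub_nonneg.2 hx) (Real.one_sub_le_exp_neg x) T
    _ = Real.exp (T * -x) := (Real.exp_nat_mul _ _).symm
    _ ≤ Real.exp (Real.log n * -r) := by
        rw [Real.exp_le_exp]
        linarith [mul_le_mul_of_nonneg_left hlog hr]
    _ = n ^ (-r) := (Real.rpow_def_of_pos (zero_lt_one.trans_le hn) _).symm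

theorem mul_one_sub_pow_mul_le_rpow_neg {a x : ℝ} {T M : ℕ} (hn : 1 ≤ n) (ha : 0 ≤ a + 2 + c)
    (hx : x ≤ 1) (hT : (a + 2 + c) * Real.logb 2 n ≤ x * T) (hM : M ≤ c * Real.logb 2 n) :
    n * ((1 - x) ^ T * (n * 2 ^ M)) ≤ n ^ (-a) := by
  have hn₀ : 0 < n := zero_lt_one.trans_le hn
  calc n * ((1 - x) ^ T * (n * 2 ^ M)) ≤ n * (n ^ (-(a + 2 + c)) * (n * n ^ c)) := by
        gcongr
        · exact one_sub_pow_le_rpow_neg hn ha hx hT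
        · exact two_pow_le_rpow hn₀ hM
    _ = n ^ (1 + (-(a + 2 + c) + (1 + c))) := by
        simp only [Real.rpow_add hn₀, Real.rpow_one]
    _ = n ^ (-a) := by ring_nf

end Numerics

end BeepingMIS

open BeepingMIS in
theorem theorem1_general (c₂ : ℝ) (hc₂ : 0 < c₂) (a : ℝ) (ha : 0 < a) :
    ∃ C : ℝ, 0 < C ∧
      ∀ (V : Type*) [Fintype V] (G : SimpleGraph V) [DecidableRel G.Adj] (lmax : V → ℕ),
        (∀ u v, G.Adj u v → lmax u = lmax v) →
        (∀ v, Real.logb 2 (max (G.degree v : ℝ) 1) + 5 ≤ (lmax v : ℝ)) →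
        (∀ v, (lmax v : ℝ) ≤ c₂ * Real.logb 2 (Fintype.card V : ℝ)) →
        ∀ l₀ : V → ℤ, IsConfiguration lmax l₀ →
          1 - (Fintype.card V : ℝ) ^ (-a) ≤
            ((run G lmax ⌊C * Real.logb 2 (Fintype.card V : ℝ)⌋₊ l₀).toOuterMeasure
              {l | IsStableMIS G lmax l}).toReal := by
  set x := aloneProb / 400 with hx
  have hx₀ : 0 < x := by norm_num [hx, aloneProb]
  have hx₁ : x ≤ 1 := by norm_num [hx, aloneProb]
  refine ⟨3 * c₂ + (a + 2 + c₂) / x, by positivity, fun V _ G _ lmax hcap hlow hup l₀ hl₀ => ?_⟩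
  change _ ≤ prob _ _
  rcases isEmpty_or_nonempty V with hV | ⟨⟨v₀⟩⟩
  · refine (sub_le_self 1 (by positivity)).trans_eq (prob_eq_one fun l _ => ?_).symm
    exact isStableMIS_of_stableSet_eq_univ isEmptyElim (Subsingleton.elim _ _)
  have hn : (1 : ℝ) ≤ Fintype.card V := by exact_mod_cast Fintype.card_pos_iff.2 ⟨v₀⟩
  have hlmax : ∀ v, 5 ≤ (lmax v : ℝ) := fun v =>
    (le_add_of_nonneg_left (Real.logb_nonneg one_lt_two (le_max_right _ _))).trans (hlow v)
  have hlog : 2 ≤ c₂ * Real.logb 2 (Fintype.card V) := by linarith [hlmax v₀, hup v₀]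
  have hlog₀ : 0 ≤ Real.logb 2 (Fintype.card V) := Real.logb_nonneg one_lt_two hn
  obtain ⟨T, hR, hT⟩ := exists_floor_eq_add (q := (a + 2 + c₂) / x) hlog (by positivity)
  have hlmax₂ : ∀ v, 2 ≤ lmax v := fun v => by
    rify
    linarith [hlmax v]
  have hfail := calc
    prob (run G lmax _ l₀) {l | ¬IsStableMIS G lmax l}
      ≤ Fintype.card V * ((1 - x) ^ T * (Fintype.card V * 2 ^ _)) :=
        prob_not_isStableMIS_le hlmax₂ (fun v => Nat.le_floor (hup v)) hcap
          (fun v => capLoad_le hcap (hlow v)) hl₀ T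
    _ ≤ (Fintype.card V : ℝ) ^ (-a) :=
        mul_one_sub_pow_mul_le_rpow_neg hn (by positivity) hx₁
          (by rwa [div_mul_eq_mul_div, div_le_iff₀' hx₀] at hT)
          (Nat.floor_le (zero_le_two.trans hlog))
  rw [← hR, ← Set.compl_ofPred, prob_compl] at hfail
  linarith

theorem theorem1 (c₁ c₂ : ℝ) (hc₁ : 15 ≤ c₁) (hc₂ : 0 < c₂) (a : ℝ) (ha : 0 < a) :
    ∃ C : ℝ, 0 < C ∧
      ∀ (V : Type*) [Fintype V] (G : SimpleGraph V) [DecidableRel G.Adj]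
        (lmax : V → ℕ) (L : ℕ),
        (∀ v, lmax v = L) →
        Real.logb 2 (max (G.maxDegree : ℝ) 1) + c₁ ≤ (L : ℝ) →
        (L : ℝ) ≤ c₂ * Real.logb 2 (Fintype.card V : ℝ) →
        ∀ l₀ : V → ℤ, BeepingMIS.IsConfiguration lmax l₀ →
          1 - (Fintype.card V : ℝ) ^ (-a) ≤
            ((BeepingMIS.run G lmax ⌊C * Real.logb 2 (Fintype.card V : ℝ)⌋₊ l₀).toOuterMeasure
              {l | BeepingMIS.IsStableMIS G lmax l}).toReal := by
  obtain ⟨C, hC, h⟩ := theorem1_general c₂ hc₂ a ha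
  refine ⟨C, hC, fun V _ G _ lmax L hL hlow hup => h V G lmax
    (fun u v _ => (hL u).trans (hL v).symm) (fun v => ?_) fun v => (hL v).symm ▸ hup⟩
  have hdeg : Real.logb 2 (max (G.degree v : ℝ) 1) ≤ Real.logb 2 (max (G.maxDegree : ℝ) 1) :=
    Real.logb_le_logb_of_le one_lt_two (by positivity) <| by gcongr; exact G.degree_le_maxDegree v
  rw [hL v]
  linarith
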